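/- The Bulgarian Solitaire move $\beta$ on the partitions of $n$ removes one card from every pile (part) and makes the removed cards into a new pile. For a word $N=b_1b_2\cdots b_m$ in the letters $B,W$, put $n_N=\binom m2+\#\{i: b_i=B\}$ and let $\mathcal C_N$ be the set of partitions of $n_N$ whose parts are the nonzero entries of $(m-1,m-2,\dots,0)+(s_1,\dots,s_m)$, where $s_1,\dots,s_m$ is obtained from a cyclic rotation of $N$ by replacing $B$ with $1$ and $W$ with $0$. Let $\mathcal O_N$ be the set of partitions $\lambda$ of $n_N$ with $\beta^j(\lambda)\in\mathcal C_N$ for some $j\ge 1$, let $\operatorname{level}(\lambda)=\min\{j\ge 0:\beta^j(\lambda)\in\mathcal C_N\}$ for $\lambda\in\mathcal O_N$, and let $\mathcal D_N(x)=\sum_{\lambda\in\mathcal O_N}x^{\operatorname{level}(\lambda)}$. For a word $P$ let $H_P(x)=\lim_{\ell\to\infty}\mathcal D_{P^\ell}(x)$, a coefficientwise limit (every coefficient is eventually constant), where $P^\ell$ is the concatenation of $\ell$ copies of $P$. Theorem. For every $k\ge 1$, the limits $H_{BW^k}(x)$ and $H_{WB^k}(x)$ exist, and both can be written as rational functions over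 the same denominator: there are polynomials $D,N_1,N_2\in\mathbb Z[x]$ with $D(0)\ne 0$ such that $$H_{BW^k}(x)=\frac{N_1(x)}{D(x)},\qquad H_{WB^k}(x)=\frac{N_2(x)}{D(x)},$$ where $\deg D=k+1$ if $k\ge 2$, and $\deg D=3$ if $k=1$. -/

import Mathlib

open Filter

namespace Bulgarian

/-- The two colours of beads: black and white. -/
inductive Bead where
  | B : Bead
  | W : Bead
deriving DecidableEq

/-- The Bulgarian Solitaire move: take one card from every pile and form a new pile from the cards
taken (`Nat.Partition.ofSums` discards the piles that have become empty). -/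
def move {n : ℕ} (lam : n.Partition) : n.Partition :=
  Nat.Partition.ofSums n (Multiset.card lam.parts ::ₘ lam.parts.map (fun a => a - 1)) (by
    have key : ∀ s : Multiset ℕ, (∀ a ∈ s, 0 < a) →
        Multiset.card s + (s.map (fun a => a - 1)).sum = s.sum := by
      intro s
      induction s using Multiset.induction_on with
      | empty => simp
      | cons a s ih =>
        intro h
        have h1 := h a (Multiset.mem_cons_self a s)
        have h2 := ih (fun b hb => h b (Multiset.mem_cons_of_mem hb))
        simp only [Multiset.card_cons, Multiset.map_cons, Multiset.sum_cons]
        omega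
    rw [Multiset.sum_cons, key _ (fun a ha => lam.parts_pos ha), lam.parts_sum])

/-- For a word `b₁ b₂ … b_m` of beads, the sequence `(m-1, m-2, …, 0) + (s₁, s₂, …, s_m)`, where
`sᵢ = 1` if `bᵢ` is black and `sᵢ = 0` if `bᵢ` is white. -/
def staircase : List Bead → List ℕ
  | [] => []
  | b :: w => (w.length + if b = Bead.B then 1 else 0) :: staircase w

/-- The number of cards that belongs to a necklace: `m choose 2` plus the number of black beads,
where `m` is the length. -/
def cards (N : List Bead) : ℕ := N.length.choose 2 + N.count Bead.B

/-- The recurrent cycle of the necklace represented by the word `N`: the partitions obtained from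
all cyclic rotations of `N` (a partition has no zero parts, hence the filter). -/
def cycle (N : List Bead) : Set (cards N).Partition :=
  {lam | ∃ w : List Bead, w ~r N ∧
    lam.parts = (staircase w : Multiset ℕ).filter (fun a => a ≠ 0)}

/-- The orbit of a necklace: all partitions that reach its recurrent cycle. -/
def orbit (N : List Bead) : Set (cards N).Partition :=
  {lam | ∃ j : ℕ, 0 < j ∧ move^[j] lam ∈ cycle N}

/-- The number of moves that a partition in the orbit needs to reach the recurrent cycle. -/
noncomputable def level (N : List Bead) (lam : (cards N).Partition) : ℕ :=
  sInf {j : ℕ | move^[j] lam ∈ cycle N}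

open Classical in
/-- The level size generating function of a necklace (a polynomial, viewed as a power series). -/
noncomputable def levelSeries (N : List Bead) : PowerSeries ℤ :=
  ∑ lam ∈ Finset.univ.filter (fun lam => lam ∈ orbit N), PowerSeries.X ^ level N lam

/-- The concatenation of `l` copies of the word `P`. -/
def wordPow (P : List Bead) (l : ℕ) : List Bead := (List.replicate l P).flatten

/-- `H` is the limit, as `l → ∞`, of the level size generating functions of the necklaces `P ^ l`:
every coefficient is eventually equal to the corresponding coefficient of `H`. -/
def IsLimitSeries (P : List Bead) (H : PowerSeries ℤ) : Prop :=
  ∀ i : ℕ, ∀ᶠ l : ℕ in atTop,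
    PowerSeries.coeff i (levelSeries (wordPow P l)) = PowerSeries.coeff i H

/-- The word `B W W ⋯ W` with `k` white beads. -/
def wordBW (k : ℕ) : List Bead := Bead.B :: List.replicate k Bead.W

/-- The word `W B B ⋯ B` with `k` black beads. -/
def wordWB (k : ℕ) : List Bead := Bead.W :: List.replicate k Bead.B

end Bulgarian

/-!
A partition `mu` with `move mu = lam` is obtained from `lam` by choosing a part `p` with
`card lam ≤ p + 1`, removing it, adding one to all other parts and filling up with parts equal to
one; then `p` is the number of parts of `mu`. Measured in the original sizes, `j` moves backward
from `lam` are therefore a choice of `j` parts of `lam`, one after the other and without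
replacement, such that no part is smaller than its predecessor by more than two (parts created on
the way are too small to be chosen, as long as `j` is small against the number of piles).

Such sequences are counted by building them up value by value, from the largest value down, instead
of step by step in time: copies of the value `v` may be inserted exactly behind an entry equal to
`v`, `v + 1` or `v + 2`. If `a` and `b` entries have the values `v + 2` and `v + 1`, this gives
`multichoose (a + b) c` ways to insert `c` copies of `v`. So the generating function is a product of
transfer matrices along the list of multiplicities of the parts (`insertionPoly`). That it counts
backward paths (`card_preimages`) comes down to the Pascal rule for `multichoose`, in the form of a
telescoping sum (`insertionPoly_succ`).

As the recurrent cycle is closed under `move`, the level size generating function agrees in low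
degrees with `1 - X` times the sum of these polynomials over the distinct rotations of the word
(`coeff_levelSeries_eq`). For the words `P ^ l` the list of multiplicities is essentially periodic,
with period `2, 0, 1, …, 1` for `B W^k` and `2, 1, …, 1, 0` for `W B^k`, with `k - 1` ones. For
`k ≥ 2` the transfer through a period has rank one in both cases: two consecutive values that are
not chosen end the construction, so only one state survives next to the multiplicity `0`. This gives
scalar recurrences `z (q + 1) = e + f * z q` and the denominators `1 - loopBW` and `1 - loopWB`.
These are equal (`loopWB_eq_loopBW`) because both satisfy the same linear recurrence of order three
in `k`, and their degree is read off from a positive leading coefficient. For `k = 1` the period is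
`2, 0`, and the two-dimensional transfer matrix has the denominator `1 - X - 3 X ^ 2 + X ^ 3`.
-/

namespace Bulgarian

open Polynomial Finset

/-! ### Counting backward paths by inserting the smallest part values last -/

/-- The generating function, by length, of the sequences that can be drawn from a decreasing run of
consecutive values with the given list of multiplicities, where an entry may drop by at most two
below its predecessor. The arguments `a` and `b` are the numbers of entries already present whose
values lie two and one above the first value of the list. The first `h` values may in addition be
inserted at the front of the sequence, which gives one more slot. -/
noncomputable def insertionPoly : ℕ → List ℕ → ℕ → ℕ → ℤ[X]
  | _, [], _, _ => 1
  | h, m :: L, a, b => ∑ c ∈ range (m + 1),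
      (Nat.multichoose (min h 1 + (a + b)) c : ℤ[X]) * X ^ c * insertionPoly (h - 1) L b c

@[simp] lemma insertionPoly_nil (h a b : ℕ) : insertionPoly h [] a b = 1 := rfl

lemma insertionPoly_cons (h m : ℕ) (L : List ℕ) (a b : ℕ) :
    insertionPoly h (m :: L) a b = ∑ c ∈ range (m + 1),
      (Nat.multichoose (min h 1 + (a + b)) c : ℤ[X]) * X ^ c * insertionPoly (h - 1) L b c := rfl

lemma insertionPoly_zero_zero (L : List ℕ) : insertionPoly 0 L 0 0 = 1 := by
  induction L with
  | nil => rfl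
  | cons m L ih =>
    rw [insertionPoly_cons, Finset.sum_range_succ']
    simp [Nat.multichoose_zero_succ, ih]

lemma coeff_zero_insertionPoly (h : ℕ) (L : List ℕ) (a b : ℕ) :
    (insertionPoly h L a b).coeff 0 = 1 := by
  induction L generalizing h a b with
  | nil => simp
  | cons m L ih =>
    rw [insertionPoly_cons, Finset.sum_range_succ']
    simp [Polynomial.mul_coeff_zero, ih]

/-- When only the next two values may be inserted at the front, the front acts as one more entry
with the value just above. -/
lemma insertionPoly_two (L : List ℕ) (b c : ℕ) :
    insertionPoly 2 L b c = insertionPoly 0 L b (c + 1) := by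
  have e : min 2 1 + (b + c) = min 0 1 + (b + (c + 1)) := by omega
  have e' : ∀ i, min (2 - 1) 1 + (c + i) = min (0 - 1) 1 + (c + 1 + i) := by intro i; omega
  rcases L with _ | ⟨m, _ | ⟨m', L⟩⟩
  · rfl
  · rw [insertionPoly_cons, insertionPoly_cons, e]
    rfl
  · rw [insertionPoly_cons, insertionPoly_cons, e]
    refine Finset.sum_congr rfl fun i _ => ?_
    rw [insertionPoly_cons, insertionPoly_cons, e']

/-- The sequences that are gained when the value at position `h` is admitted at the front are those
that start with it. The rest of such a sequence avoids one copy of that value, and its own first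
entry may lie up to two positions further down. -/
lemma insertionPoly_succ (h : ℕ) (L : List ℕ) (a b : ℕ) :
    insertionPoly (h + 1) L a b = insertionPoly h L a b +
      if L.getD h 0 = 0 then 0 else X * insertionPoly (h + 3) (L.set h (L.getD h 0 - 1)) a b := by
  induction h generalizing L a b with
  | zero =>
    rcases L with _ | ⟨_ | m, L⟩
    · simp
    · simp [insertionPoly_cons]
    · simp only [List.getD_cons_zero, List.set_cons_zero, Nat.add_sub_cancel, insertionPoly_cons,
        Nat.succ_ne_zero, if_false, Finset.mul_sum]
      rw [Finset.sum_range_succ', Finset.sum_range_succ' _ (m + 1), add_right_comm,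
        ← Finset.sum_add_distrib]
      congr 1
      -- The Pascal rule splits the insertions of `c + 1` copies by whether one stands at the front.
      · refine Finset.sum_congr rfl fun c _ => ?_
        have e : min (0 + 1) 1 + (a + b) = (a + b) + 1 := by omega
        have e' : min (0 + 3) 1 + (a + b) = (a + b) + 1 := by omega
        have e0 : min 0 1 + (a + b) = a + b := by omega
        rw [e, e', e0, Nat.multichoose_succ_succ]
        have := insertionPoly_two L b c
        simp only [Nat.reduceSub, zero_add] at *
        rw [this]
        push_cast
        ring
      · simp
  | succ h ih =>
    rcases L with _ | ⟨m, L⟩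
    · simp
    · rw [insertionPoly_cons, insertionPoly_cons]
      simp only [List.getD_cons_succ, List.set_cons_succ]
      have e : ∀ h' : ℕ, min (h' + 1) 1 = 1 := by intro; omega
      have e3 : h + 1 + 3 = (h + 3) + 1 := by omega
      rw [e, e, e3]
      simp only [Nat.add_sub_cancel]
      simp_rw [ih L b _]
      split_ifs with h0
      · simp
      · rw [insertionPoly_cons, e, Nat.add_sub_cancel, Finset.mul_sum, ← Finset.sum_add_distrib]
        refine Finset.sum_congr rfl fun c _ => ?_
        ring

/-- A sequence is empty, or it starts with one of the first `h` values. -/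
lemma insertionPoly_eq_sum (h : ℕ) (L : List ℕ) :
    insertionPoly h L 0 0 = 1 + X * ∑ v ∈ (range h).filter (fun v => L.getD v 0 ≠ 0),
      insertionPoly (v + 3) (L.set v (L.getD v 0 - 1)) 0 0 := by
  induction h with
  | zero => simp [insertionPoly_zero_zero]
  | succ h ih =>
    rw [insertionPoly_succ, ih, Finset.range_add_one, Finset.filter_insert]
    by_cases h0 : L.getD h 0 = 0
    · rw [if_pos h0, if_neg (not_not.2 h0), add_zero]
    · rw [if_neg h0, if_pos h0, Finset.sum_insert (by simp)]
      ring

/-! ### Preimages under the move -/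

lemma move_parts {n : ℕ} (lam : n.Partition) :
    (move lam).parts =
      (Multiset.card lam.parts ::ₘ lam.parts.map (fun a => a - 1)).filter (fun a => a ≠ 0) := rfl

/-- A multiset of positive numbers is recovered from the nonzero numbers `a - 1` and its
cardinality. -/
lemma eq_map_add_replicate (s : Multiset ℕ) (hs : ∀ a ∈ s, 0 < a) :
    s = ((s.map (fun a => a - 1)).filter (fun a => a ≠ 0)).map (fun a => a + 1) +
      Multiset.replicate
        (Multiset.card s - Multiset.card ((s.map (fun a => a - 1)).filter (fun a => a ≠ 0))) 1 ∧
    Multiset.card ((s.map (fun a => a - 1)).filter (fun a => a ≠ 0)) ≤ Multiset.card s := by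
  have hle : ∀ t : Multiset ℕ,
      Multiset.card ((t.map (fun a => a - 1)).filter (fun a => a ≠ 0)) ≤ Multiset.card t := by
    intro t
    refine (Multiset.card_le_card (Multiset.filter_le _ _)).trans ?_
    rw [Multiset.card_map]
  refine ⟨?_, hle s⟩
  induction s using Multiset.induction_on with
  | empty => simp
  | cons a s ih =>
    have ha := hs a (Multiset.mem_cons_self a s)
    have ih' := ih fun b hb => hs b (Multiset.mem_cons_of_mem hb)
    have hl := hle s
    rcases Nat.lt_or_ge 1 a with h | h
    · rw [Multiset.map_cons, Multiset.filter_cons_of_pos _ (by omega), Multiset.map_cons,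
        Multiset.card_cons, Multiset.card_cons, Multiset.cons_add, Nat.add_sub_add_right, ← ih']
      congr 1
      omega
    · obtain rfl : a = 1 := by omega
      rw [Multiset.map_cons, Multiset.filter_cons_of_neg _ (by simp), Multiset.card_cons,
        Nat.sub_add_comm hl, Multiset.replicate_succ, Multiset.add_cons, ← ih']

/-- A preimage of `lam` is determined by its number of parts, which is a part of `lam`. -/
lemma parts_of_move_eq {n : ℕ} {lam mu : n.Partition} (h : move mu = lam)
    (h0 : Multiset.card mu.parts ≠ 0) :
    Multiset.card mu.parts ∈ lam.parts ∧
    Multiset.card lam.parts ≤ Multiset.card mu.parts + 1 ∧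
    mu.parts = (lam.parts.erase (Multiset.card mu.parts)).map (fun a => a + 1) +
      Multiset.replicate (Multiset.card mu.parts + 1 - Multiset.card lam.parts) 1 := by
  obtain ⟨h1, h2⟩ := eq_map_add_replicate mu.parts fun a ha => mu.parts_pos ha
  have hl : lam.parts = Multiset.card mu.parts ::ₘ
      (mu.parts.map (fun a => a - 1)).filter (fun a => a ≠ 0) := by
    rw [← h, move_parts, Multiset.filter_cons_of_pos (p := fun a => a ≠ 0) _ h0]
  refine ⟨by simp [hl], by simpa [hl] using h2, ?_⟩
  rw [hl, Multiset.erase_cons_head, Multiset.card_cons, Nat.add_sub_add_right]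
  exact h1

lemma exists_move_eq {n : ℕ} (lam : n.Partition) {p : ℕ} (hp : p ∈ lam.parts)
    (hc : Multiset.card lam.parts ≤ p + 1) :
    ∃ mu : n.Partition, move mu = lam ∧ Multiset.card mu.parts = p := by
  obtain ⟨t, ht⟩ := Multiset.exists_cons_of_mem hp
  have hct : Multiset.card t ≤ p := by
    rw [ht, Multiset.card_cons] at hc; omega
  have hsum : lam.parts.sum = n := lam.parts_sum
  have htpos : ∀ a ∈ t, a ≠ 0 := fun a ha =>
    (lam.parts_pos (by rw [ht]; exact Multiset.mem_cons_of_mem ha)).ne'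
  let mu : n.Partition :=
    { parts := t.map (fun a => a + 1) + Multiset.replicate (p - Multiset.card t) 1
      parts_pos := by
        intro i hi
        rcases Multiset.mem_add.1 hi with h | h
        · obtain ⟨a, _, rfl⟩ := Multiset.mem_map.1 h
          omega
        · rw [Multiset.eq_of_mem_replicate h]
          exact one_pos
      parts_sum := by
        rw [Multiset.sum_add, Multiset.sum_map_add, Multiset.sum_replicate, Multiset.map_id',
          Multiset.map_const', Multiset.sum_replicate, ← hsum, ht, Multiset.sum_cons]
        simp only [smul_eq_mul, mul_one]
        omega }
  have hcard : Multiset.card mu.parts = p := by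
    simp only [mu, Multiset.card_add, Multiset.card_map, Multiset.card_replicate]
    omega
  refine ⟨mu, ?_, hcard⟩
  apply Nat.Partition.ext
  have hp0 : p ≠ 0 := (lam.parts_pos hp).ne'
  rw [move_parts, hcard, Multiset.filter_cons_of_pos (p := fun a => a ≠ 0) _ hp0, ht]
  congr 1
  simp only [mu, Multiset.map_add, Multiset.map_map, Multiset.map_replicate, Multiset.filter_add]
  have hr : (Multiset.replicate (p - Multiset.card t) (1 - 1)).filter (fun a => a ≠ 0) = 0 :=
    Multiset.filter_eq_nil.2 fun a ha => by simp [Multiset.eq_of_mem_replicate ha]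
  rw [hr, add_zero]
  simp only [Function.comp_def, Nat.add_sub_cancel, Multiset.map_id']
  exact Multiset.filter_eq_self.2 htpos

/-- The number of partitions that arrive at `lam` after exactly `j` moves is a coefficient of the
insertion polynomial of the multiplicities of the parts `M, M - 1, …` of `lam`. The equation for `h`
says that the parts `p` with `card lam ≤ p + 1` are those at the positions below `h`; the bounds on
the length of `L` ensure that `j` steps neither leave the list nor reach a newly created part. -/
theorem card_preimages {n : ℕ} (j : ℕ) : ∀ (lam : n.Partition) (M h : ℕ) (L : List ℕ),
    (∀ a ∈ lam.parts, a ≤ M) → h + Multiset.card lam.parts = M + 2 →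
    (∀ v < L.length, L.getD v 0 = lam.parts.count (M - v)) → L.length ≤ M →
    h + 2 * j ≤ L.length →
    ((univ.filter (fun mu : n.Partition => move^[j] mu = lam)).card : ℤ) =
      (insertionPoly h L 0 0).coeff j := by
  induction j with
  | zero =>
    intro lam M h L _ _ _ _ _
    rw [coeff_zero_insertionPoly, Finset.card_eq_one.2 ⟨lam, by
      ext mu
      rw [Finset.mem_filter, Finset.mem_singleton]
      exact and_iff_right (Finset.mem_univ _)⟩, Nat.cast_one]
  | succ j ih =>
    intro lam M h L hM hh hL hLM hj
    rw [insertionPoly_eq_sum, Polynomial.coeff_add, Polynomial.coeff_one, if_neg (by omega),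
      zero_add, Polynomial.coeff_X_mul, Polynomial.finsetSum_coeff]
    have hfib : (univ.filter (fun mu : n.Partition => move^[j + 1] mu = lam)).card =
        ∑ nu ∈ univ.filter (fun nu : n.Partition => move nu = lam),
          (univ.filter (fun mu : n.Partition => move^[j] mu = nu)).card := by
      rw [Finset.card_eq_sum_card_fiberwise (f := fun mu => move^[j] mu)
        (t := univ.filter (fun nu : n.Partition => move nu = lam))]
      · refine Finset.sum_congr rfl fun nu hnu => ?_
        congr 1
        ext mu
        simp only [Finset.mem_filter, Finset.mem_univ, true_and] at hnu ⊢
        refine ⟨fun h => h.2, fun h => ⟨?_, h⟩⟩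
        rw [Function.iterate_succ_apply', h, hnu]
      · intro mu hmu
        simp only [Finset.coe_filter, Finset.mem_univ, true_and, Set.mem_ofPred_eq] at hmu ⊢
        rwa [Function.iterate_succ_apply'] at hmu
    rw [hfib, Nat.cast_sum]
    have hne : ∀ nu : n.Partition, move nu = lam → Multiset.card nu.parts ≠ 0 := by
      intro nu hnu h0
      have h1 : lam.parts = 0 := by
        rw [← hnu, move_parts, Multiset.card_eq_zero.1 h0]
        simp
      rw [h1, Multiset.card_zero] at hh
      omega
    -- A preimage `nu` corresponds to the position of the part of `lam` that equals its number of
    -- parts.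
    refine Finset.sum_bij (fun nu _ => M - Multiset.card nu.parts) ?_ ?_ ?_ ?_
    · intro nu hnu
      have hnu' := (Finset.mem_filter.1 hnu).2
      obtain ⟨h1, h2, -⟩ := parts_of_move_eq hnu' (hne nu hnu')
      have h3 := hM _ h1
      have hlt : M - Multiset.card nu.parts < h := by omega
      rw [Finset.mem_filter, Finset.mem_range, hL _ (by omega), Nat.sub_sub_self h3]
      exact ⟨hlt, (Multiset.count_pos.2 h1).ne'⟩
    · intro nu hnu nu' hnu' heq
      have hnu := (Finset.mem_filter.1 hnu).2
      have hnu' := (Finset.mem_filter.1 hnu').2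
      obtain ⟨h1, h2, h3⟩ := parts_of_move_eq hnu (hne nu hnu)
      obtain ⟨h1', h2', h3'⟩ := parts_of_move_eq hnu' (hne nu' hnu')
      have h4 := hM _ h1
      have h4' := hM _ h1'
      have hcc : Multiset.card nu.parts = Multiset.card nu'.parts := by
        omega
      apply Nat.Partition.ext
      rw [h3, h3', hcc]
    · intro v hv
      obtain ⟨hv1, hv2⟩ := Finset.mem_filter.1 hv
      rw [Finset.mem_range] at hv1
      rw [hL _ (by omega)] at hv2
      have hmem : M - v ∈ lam.parts := Multiset.count_pos.1 (Nat.pos_of_ne_zero hv2)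
      obtain ⟨mu, hmu, hcard⟩ := exists_move_eq lam hmem (by omega)
      exact ⟨mu, by simpa using hmu, by omega⟩
    · intro nu hnu
      have hnu := (Finset.mem_filter.1 hnu).2
      obtain ⟨h1, h2, h3⟩ := parts_of_move_eq hnu (hne nu hnu)
      have h4 := hM _ h1
      set p := Multiset.card nu.parts with hp
      -- All old parts grow by one, so with `M + 1` in place of `M` their positions do not change.
      apply ih nu (M + 1)
      · intro a ha
        rw [h3] at ha
        rcases Multiset.mem_add.1 ha with ha | ha
        · obtain ⟨b, hb, rfl⟩ := Multiset.mem_map.1 ha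
          have := hM b (Multiset.mem_of_mem_erase hb)
          omega
        · rw [Multiset.eq_of_mem_replicate ha]
          omega
      · omega
      · intro v hv
        rw [List.length_set] at hv
        have e : M + 1 - v = (M - v) + 1 := by omega
        rw [h3, Multiset.count_add, Multiset.count_replicate, if_neg (by omega), add_zero, e,
          Multiset.count_map_eq_count' (fun a => a + 1) _ (add_left_injective 1)]
        by_cases hvp : v = M - p
        · subst hvp
          rw [Nat.sub_sub_self h4, Multiset.count_erase_self, List.getD_eq_getElem _ _ (by simpa),
            List.getElem_set_self, hL _ hv, Nat.sub_sub_self h4]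
        · rw [Multiset.count_erase_of_ne (by omega), ← hL v hv, List.getD_eq_getElem _ _ (by simpa),
            List.getElem_set_ne (fun h => hvp h.symm), List.getD_eq_getElem _ _ hv]
      · rw [List.length_set]
        omega
      · rw [List.length_set]
        omega

/-! ### Recurrent partitions and level sizes -/

/-- The multiplicities that a word, read after the bead `b`, contributes to the parts of its
staircase. The parts of two neighbouring positions `i`, `i + 1` have the value `m - i` in common: it
is taken at `i` if that bead is white and at `i + 1` if that bead is black. -/
def pairMults : Bead → List Bead → List ℕ
  | _, [] => []
  | b, c :: w =>
    ((if b = Bead.W then 1 else 0) + if c = Bead.B then 1 else 0) :: pairMults c w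

/-- The list of multiplicities of the values `m, m - 1, …, 1` in the staircase of a word of
length `m`. -/
def wordMults : List Bead → List ℕ
  | [] => []
  | b :: w => (if b = Bead.B then 1 else 0) :: pairMults b w

@[simp] lemma length_pairMults (b : Bead) (w : List Bead) :
    (pairMults b w).length = w.length := by
  induction w generalizing b with
  | nil => rfl
  | cons c w ih => simp [pairMults, ih]

@[simp] lemma length_wordMults (w : List Bead) : (wordMults w).length = w.length := by
  cases w <;> simp [wordMults]

@[simp] lemma length_staircase (w : List Bead) : (staircase w).length = w.length := by
  induction w with
  | nil => rfl
  | cons b w ih => simp [staircase, ih]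

lemma le_length_of_mem_staircase {w : List Bead} {a : ℕ} (ha : a ∈ staircase w) :
    a ≤ w.length := by
  induction w with
  | nil => simp [staircase] at ha
  | cons b w ih =>
    rw [staircase, List.mem_cons] at ha
    rw [List.length_cons]
    rcases ha with rfl | ha
    · split_ifs <;> omega
    · have := ih ha
      omega

lemma pairMults_getD (b : Bead) {w : List Bead} {v : ℕ} (hv : v < w.length) :
    (pairMults b w).getD v 0 =
      (if v = 0 ∧ b = Bead.W then 1 else 0) + (wordMults w).getD v 0 := by
  rcases w with _ | ⟨c, w⟩
  · simp at hv
  · rcases v with _ | v <;> simp [pairMults, wordMults]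

lemma wordMults_getD {w : List Bead} {v : ℕ} (hv : v < w.length) :
    (wordMults w).getD v 0 = (staircase w).count (w.length - v) := by
  induction w generalizing v with
  | nil => simp at hv
  | cons b w ih =>
    rw [staircase, List.count_cons, List.length_cons]
    rcases v with _ | v
    · rw [List.count_eq_zero_of_not_mem]
      · cases b <;> simp [wordMults]
      · intro h
        have := le_length_of_mem_staircase h
        omega
    · have hv' : v < w.length := by simpa using hv
      rw [wordMults, List.getD_cons_succ, pairMults_getD b hv', ih hv', Nat.add_sub_add_right,
        add_comm]
      congr 1
      cases b
      · have : ¬ w.length + 1 = w.length - v := by omega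
        simp [this]
      · by_cases h0 : v = 0
        · simp [h0]
        · have : ¬ w.length = w.length - v := by omega
          simp [h0, this]

lemma staircase_concat (w : List Bead) (b : Bead) :
    staircase (w ++ [b]) =
      (staircase w).map (fun a => a + 1) ++ [if b = Bead.B then 1 else 0] := by
  induction w with
  | nil => simp [staircase]
  | cons c w ih =>
    simp [staircase, ih]
    omega

lemma sum_staircase (w : List Bead) : (staircase w).sum = cards w := by
  induction w with
  | nil => rfl
  | cons b w ih =>
    rw [staircase, List.sum_cons, ih, cards, cards, List.length_cons, Nat.choose_succ_succ' _ 1,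
      Nat.choose_one_right, List.count_cons]
    cases b <;> simp <;> omega

lemma staircase_pairwise (w : List Bead) : (staircase w).Pairwise (· ≥ ·) := by
  induction w with
  | nil => exact List.Pairwise.nil
  | cons b w ih =>
    refine List.pairwise_cons.2 ⟨fun a ha => ?_, ih⟩
    have := le_length_of_mem_staircase ha
    omega

lemma staircase_injective : Function.Injective staircase := by
  intro u
  induction u with
  | nil =>
    intro v h
    cases v with
    | nil => rfl
    | cons c v => simp [staircase] at h
  | cons b u ih =>
    intro v h
    cases v with
    | nil => simp [staircase] at h
    | cons c v =>
      rw [staircase, staircase, List.cons.injEq] at h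
      obtain rfl := ih h.2
      have h1 := h.1
      cases b <;> cases c <;> simp_all

lemma filter_ne_zero_add (s : Multiset ℕ) :
    s = s.filter (fun a => a ≠ 0) +
      Multiset.replicate (Multiset.card s - Multiset.card (s.filter (fun a => a ≠ 0))) 0 := by
  have h := Multiset.filter_add_not (fun a => a ≠ 0) s
  have h2 : s.filter (fun a => ¬ a ≠ 0) =
      Multiset.replicate (Multiset.card (s.filter (fun a => ¬ a ≠ 0))) 0 :=
    Multiset.eq_replicate_card.2 fun b hb => not_not.1 (Multiset.mem_filter.1 hb).2
  have h3 := congrArg Multiset.card h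
  rw [Multiset.card_add] at h3
  have h4 : Multiset.card s - Multiset.card (s.filter (fun a => a ≠ 0)) =
      Multiset.card (s.filter (fun a => ¬ a ≠ 0)) := by omega
  rw [h4, ← h2, h]

lemma eq_of_filter_staircase_eq {u v : List Bead} (hlen : u.length = v.length)
    (h : (staircase u : Multiset ℕ).filter (fun a => a ≠ 0) =
      (staircase v : Multiset ℕ).filter (fun a => a ≠ 0)) : u = v := by
  apply staircase_injective
  have h1 : (staircase u : Multiset ℕ) = (staircase v : Multiset ℕ) := by
    rw [filter_ne_zero_add (staircase u : Multiset ℕ),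
      filter_ne_zero_add (staircase v : Multiset ℕ), h, Multiset.coe_card,
      Multiset.coe_card, length_staircase, length_staircase, hlen]
  exact (Multiset.coe_eq_coe.1 h1).eq_of_pairwise' (staircase_pairwise u) (staircase_pairwise v)

lemma filter_staircase_concat (w : List Bead) (b : Bead) :
    (staircase (w ++ [b]) : Multiset ℕ).filter (fun a => a ≠ 0) =
      (staircase w : Multiset ℕ).map (fun a => a + 1) + if b = Bead.B then {1} else 0 := by
  rw [staircase_concat, ← Multiset.coe_add, ← Multiset.map_coe, Multiset.filter_add]
  congr 1
  · refine Multiset.filter_eq_self.2 fun a ha => ?_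
    obtain ⟨b, _, rfl⟩ := Multiset.mem_map.1 ha
    omega
  · cases b <;> rfl

lemma move_mem_cycle {N : List Bead} {lam : (cards N).Partition} (h : lam ∈ cycle N) :
    move lam ∈ cycle N := by
  obtain ⟨w, hw, hl⟩ := h
  rcases List.eq_nil_or_concat' w with rfl | ⟨u, b, rfl⟩
  · refine ⟨[], hw, ?_⟩
    have h0 : lam.parts = 0 := by simpa [staircase] using hl
    rw [move_parts, h0]
    rfl
  · refine ⟨b :: u, List.IsRotated.trans ⟨1, by simp⟩ hw, ?_⟩
    rw [filter_staircase_concat] at hl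
    rw [move_parts, hl, staircase, Multiset.map_add, Multiset.card_add, Multiset.map_map,
      Multiset.card_map, Multiset.coe_card, length_staircase, ← Multiset.cons_coe]
    simp only [Function.comp_def, Nat.add_sub_cancel, Multiset.map_id']
    cases b
    · simp only [if_true, Multiset.card_singleton, Multiset.map_singleton, Nat.sub_self]
      rw [Multiset.filter_cons, Multiset.filter_add, Multiset.filter_cons]
      simp [Multiset.filter_singleton]
    · simp

lemma iterate_move_mem_cycle {N : List Bead} {lam : (cards N).Partition} {i j : ℕ} (hij : i ≤ j)
    (h : move^[i] lam ∈ cycle N) : move^[j] lam ∈ cycle N := by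
  induction j, hij using Nat.le_induction with
  | base => exact h
  | succ j _ ih =>
    rw [Function.iterate_succ_apply']
    exact move_mem_cycle ih

open Classical in
lemma coeff_levelSeries (N : List Bead) (i : ℕ) :
    PowerSeries.coeff i (levelSeries N) =
      ((univ.filter fun lam : (cards N).Partition =>
        move^[i] lam ∈ cycle N ∧ ∀ j < i, move^[j] lam ∉ cycle N).card : ℤ) := by
  rw [levelSeries, map_sum, Finset.card_filter, Finset.sum_filter, Nat.cast_sum]
  refine Finset.sum_congr rfl fun lam _ => ?_
  rw [PowerSeries.coeff_X_pow, ← ite_and, Nat.cast_ite, Nat.cast_one, Nat.cast_zero]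
  refine if_congr ?_ rfl rfl
  rw [level]
  constructor
  · rintro ⟨⟨j, _, hj⟩, rfl⟩
    exact ⟨Nat.sInf_mem (s := {j : ℕ | move^[j] lam ∈ cycle N}) ⟨j, hj⟩,
      fun j' hj' => Nat.notMem_of_lt_sInf hj'⟩
  · rintro ⟨h1, h2⟩
    refine ⟨⟨i + 1, Nat.succ_pos i, iterate_move_mem_cycle (Nat.le_succ i) h1⟩, ?_⟩
    refine le_antisymm ?_ (Nat.sInf_le h1)
    by_contra hlt
    exact h2 _ (not_le.1 hlt)
      (Nat.sInf_mem (s := {j : ℕ | move^[j] lam ∈ cycle N}) ⟨i, h1⟩)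

/-- The insertion polynomial of the recurrent partition of a word. A partition of a word of length
`m` has `m` parts if the last bead is black and `m - 1` parts otherwise, so that the parts of size
at least `m - 1`, respectively `m - 2`, can be chosen in the first backward move. -/
noncomputable def wordPoly (w : List Bead) : ℤ[X] :=
  insertionPoly (if w.getLast? = some Bead.B then 2 else 3) (wordMults w) 0 0

lemma cards_eq_of_isRotated {u v : List Bead} (h : u ~r v) : cards u = cards v := by
  rw [cards, cards, h.perm.length_eq, h.perm.count_eq]

lemma card_preimages_word {n : ℕ} {lam : n.Partition} {w : List Bead}
    (hl : lam.parts = (staircase w : Multiset ℕ).filter (fun a => a ≠ 0)) {j : ℕ}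
    (hj : 3 + 2 * j ≤ w.length) :
    ((univ.filter (fun mu : n.Partition => move^[j] mu = lam)).card : ℤ) =
      (wordPoly w).coeff j := by
  refine card_preimages j lam w.length _ _ ?_ ?_ ?_ ?_ ?_
  · intro a ha
    rw [hl, Multiset.mem_filter] at ha
    exact le_length_of_mem_staircase ha.1
  · rcases List.eq_nil_or_concat' w with rfl | ⟨u, b, rfl⟩
    · simp at hj
    · rw [hl, filter_staircase_concat]
      cases b <;> simp <;> omega
  · intro v hv
    rw [length_wordMults] at hv
    rw [wordMults_getD hv, hl, Multiset.count_filter_of_pos (by omega), Multiset.coe_count]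
  · rw [length_wordMults]
  · rw [length_wordMults]
    split_ifs <;> omega

open Classical in
lemma card_iterate_mem_cycle (N : List Bead) (s : Finset (List Bead))
    (hs : ∀ w, w ∈ s ↔ w ~r N) {j : ℕ} (hj : 3 + 2 * j ≤ N.length) :
    ((univ.filter fun lam : (cards N).Partition => move^[j] lam ∈ cycle N).card : ℤ) =
      (∑ w ∈ s, wordPoly w).coeff j := by
  rw [Finset.card_eq_sum_card_fiberwise (f := fun lam => move^[j] lam)
    (t := univ.filter fun lam => lam ∈ cycle N) (fun lam h => by simpa using h), Nat.cast_sum,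
    Polynomial.finsetSum_coeff]
  symm
  have hsum : ∀ w ∈ s, ((staircase w : Multiset ℕ)).sum = cards N := fun w hw => by
    rw [Multiset.sum_coe, sum_staircase, cards_eq_of_isRotated ((hs w).1 hw)]
  refine Finset.sum_bij (fun w hw => Nat.Partition.ofSums _ _ (hsum w hw)) ?_ ?_ ?_ ?_
  · intro w hw
    rw [Finset.mem_filter]
    exact ⟨Finset.mem_univ _, w, (hs w).1 hw, rfl⟩
  · intro u hu v hv h
    refine eq_of_filter_staircase_eq ?_ (congrArg Nat.Partition.parts h)
    rw [((hs u).1 hu).perm.length_eq, ((hs v).1 hv).perm.length_eq]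
  · intro lam hlam
    obtain ⟨w, hw, h⟩ := (Finset.mem_filter.1 hlam).2
    exact ⟨w, (hs w).2 hw, Nat.Partition.ext h.symm⟩
  · intro w hw
    rw [← card_preimages_word (n := cards N)
      (lam := Nat.Partition.ofSums _ _ (hsum w hw)) rfl
      (by rwa [((hs w).1 hw).perm.length_eq])]
    congr 2
    ext lam
    simp only [Finset.mem_filter, Finset.mem_univ, true_and]
    refine ⟨fun h => ⟨?_, h⟩, fun h => h.2⟩
    rw [h]
    exact ⟨w, (hs w).1 hw, rfl⟩

/-- As long as `i` is small against the length of `N`, the `i`-th level size is the difference of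
the numbers of partitions that are on the cycle after `i` and after `i - 1` moves. -/
lemma coeff_levelSeries_eq (N : List Bead) (s : Finset (List Bead))
    (hs : ∀ w, w ∈ s ↔ w ~r N) {i : ℕ} (hi : 3 + 2 * i ≤ N.length) :
    PowerSeries.coeff i (levelSeries N) = ((1 - X) * ∑ w ∈ s, wordPoly w).coeff i := by
  classical
  rw [coeff_levelSeries, sub_mul, one_mul, Polynomial.coeff_sub]
  rcases i with _ | i
  · rw [Polynomial.coeff_X_mul_zero, sub_zero, ← card_iterate_mem_cycle N s hs hi]
    congr 2
    ext lam
    rw [Finset.mem_filter, Finset.mem_filter]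
    simp
  · rw [Polynomial.coeff_X_mul, ← card_iterate_mem_cycle N s hs hi,
      ← card_iterate_mem_cycle N s hs (by omega), eq_sub_iff_add_eq, ← Nat.cast_add,
      ← Finset.card_union_of_disjoint]
    · congr 2
      ext lam
      simp only [Finset.mem_union, Finset.mem_filter, Finset.mem_univ, true_and]
      constructor
      · rintro (h | h)
        · exact h.1
        · exact iterate_move_mem_cycle (Nat.le_succ i) h
      · intro h
        by_cases h' : move^[i] lam ∈ cycle N
        · exact Or.inr h'
        · exact Or.inl ⟨h, fun j hj hc => h' (iterate_move_mem_cycle (by omega) hc)⟩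
    · rw [Finset.disjoint_left]
      intro lam h1 h2
      exact (Finset.mem_filter.1 h1).2.2 i (Nat.lt_succ_self i) (Finset.mem_filter.1 h2).2

/-! ### Rotations of a power of a word -/

lemma wordPow_succ (P : List Bead) (q : ℕ) : wordPow P (q + 1) = P ++ wordPow P q := by
  simp [wordPow, List.replicate_succ]

lemma wordPow_succ' (P : List Bead) (q : ℕ) : wordPow P (q + 1) = wordPow P q ++ P := by
  simp [wordPow, List.replicate_succ']

lemma length_wordPow (P : List Bead) (q : ℕ) : (wordPow P q).length = q * P.length := by
  simp [wordPow]

/-- The rotation by `r` letters of `P ^ (q + 1)`, for `r` at most the length of `P`. -/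
def rotWord (P : List Bead) (q r : ℕ) : List Bead := P.drop r ++ (wordPow P q ++ P.take r)

lemma rotate_wordPow (P : List Bead) (q : ℕ) {r : ℕ} (hr : r ≤ P.length) :
    (wordPow P (q + 1)).rotate r = rotWord P q r := by
  rw [wordPow_succ, List.rotate_eq_drop_append_take (by simp; omega),
    List.drop_append_of_le_length hr, List.take_append_of_le_length hr, rotWord, List.append_assoc]

lemma isRotated_wordPow_iff {P : List Bead} (hP : P ≠ []) (q : ℕ) (w : List Bead) :
    w ~r wordPow P (q + 1) ↔ ∃ r < P.length, w = rotWord P q r := by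
  have hpos : 0 < P.length := List.length_pos_iff.2 hP
  constructor
  · intro h
    obtain ⟨n, hn⟩ := h.symm
    refine ⟨n % P.length, Nat.mod_lt _ hpos, ?_⟩
    rw [← rotate_wordPow P q (Nat.mod_lt _ hpos).le, ← hn]
    have key : ∀ a, (wordPow P (q + 1)).rotate (P.length * a) = wordPow P (q + 1) := by
      intro a
      induction a with
      | zero => simp
      | succ a ih =>
        rw [Nat.mul_succ, ← List.rotate_rotate, ih, wordPow_succ, List.rotate_append_length_eq,
          ← wordPow_succ', wordPow_succ]
    conv_lhs => rw [← Nat.div_add_mod n P.length, ← List.rotate_rotate, key]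
  · rintro ⟨r, hr, rfl⟩
    rw [← rotate_wordPow P q hr.le]
    exact (List.IsRotated.symm ⟨r, rfl⟩)

/-- The rotations of `P ^ (q + 1)` by `r < P.length` differ if the first letter of `P` occurs only
once in it. -/
lemma rotWord_injOn {P : List Bead}
    (huniq : ∀ i (hi : i < P.length), P[i] = P[0] → i = 0) (q : ℕ) :
    Set.InjOn (rotWord P q) (range P.length : Set ℕ) := by
  have key : ∀ r < P.length, (rotWord P q r).take P.length = P.rotate r := by
    intro r hr
    rw [List.rotate_eq_drop_append_take hr.le, rotWord]
    cases q with
    | zero => simp [wordPow]; omega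
    | succ q =>
      rw [wordPow_succ]
      have h1 : P.drop r ++ (P ++ wordPow P q ++ P.take r) =
          (P.drop r ++ P.take r) ++ (P.drop r ++ (wordPow P q ++ P.take r)) := by
        rw [List.append_assoc P, List.append_assoc (P.drop r), ← List.append_assoc (P.take r),
          List.take_append_drop]
      have h2 : (P.drop r ++ P.take r).length = P.length := by
        simp only [List.length_append, List.length_drop, List.length_take]
        omega
      rw [h1, List.take_append_of_le_length h2.ge, List.take_of_length_le h2.le]
  intro r hr r' hr' h
  simp only [Finset.coe_range, Set.mem_Iio] at hr hr'
  have h2 : P.rotate r = P.rotate r' := by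
    rw [← key r hr, ← key r' hr', h]
  -- The rotation by `r` moves the first letter of `P` to the index `(P.length - r) % P.length`.
  have hi : (P.length - r) % P.length < P.length := Nat.mod_lt _ (by omega)
  have h3 : (P.rotate r)[(P.length - r) % P.length]'(by simpa using hi) =
      (P.rotate r')[(P.length - r) % P.length]'(by simpa using hi) := by
    simp only [h2]
  rw [List.getElem_rotate, List.getElem_rotate] at h3
  have e1 : ((P.length - r) % P.length + r) % P.length = 0 := by
    rw [Nat.mod_add_mod, Nat.sub_add_cancel hr.le, Nat.mod_self]
  simp only [e1] at h3
  have h4 := huniq _ _ h3.symm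
  rw [Nat.mod_add_mod] at h4
  obtain ⟨c, hc⟩ := Nat.dvd_of_mod_eq_zero h4
  have hc1 : c = 1 := by
    rcases c with _ | _ | c
    · omega
    · rfl
    · have : P.length * (c + 1 + 1) = P.length * c + P.length + P.length := by ring
      have := Nat.zero_le (P.length * c)
      omega
  subst hc1
  omega

/-! ### Rational limits with a given denominator -/

/-- For `D` with constant coefficient `1`, this says that the polynomials `u q` converge
coefficientwise to the power series `N / D` for some polynomial `N`. -/
def HasRationalLimit (D : ℤ[X]) (u : ℕ → ℤ[X]) : Prop :=
  ∃ N : ℤ[X], ∀ i : ℕ, ∀ᶠ q in atTop, X ^ i ∣ D * u q - N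

theorem exists_isLimitSeries {P : List Bead} (hP : P ≠ [])
    (huniq : ∀ i (hi : i < P.length), P[i] = P[0] → i = 0) {D : ℤ[X]} (hD : D.coeff 0 = 1)
    (h : HasRationalLimit D fun q => ∑ r ∈ range P.length, wordPoly (rotWord P q r)) :
    ∃ (H : PowerSeries ℤ) (N : ℤ[X]), IsLimitSeries P H ∧
      (D : PowerSeries ℤ) * H = (N : PowerSeries ℤ) := by
  obtain ⟨N, hN⟩ := h
  have hpos : 0 < P.length := List.length_pos_iff.2 hP
  have hunit : IsUnit (D : PowerSeries ℤ) := by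
    rw [PowerSeries.isUnit_iff_constantCoeff]
    rw [← PowerSeries.coeff_zero_eq_constantCoeff_apply, Polynomial.coeff_coe, hD]
    exact isUnit_one
  obtain ⟨V, hV⟩ := hunit.exists_right_inv
  refine ⟨V * (((1 - X) * N : ℤ[X]) : PowerSeries ℤ), (1 - X) * N, ?_, by
    rw [← mul_assoc, hV, one_mul]⟩
  intro i
  obtain ⟨a, ha⟩ := eventually_atTop.1 (hN (i + 1))
  refine eventually_atTop.2 ⟨a + (3 + 2 * i) + 1, fun l hl => ?_⟩
  obtain ⟨q, rfl⟩ : ∃ q, l = q + 1 := ⟨l - 1, by omega⟩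
  have hlen : 3 + 2 * i ≤ (wordPow P (q + 1)).length := by
    rw [length_wordPow]
    exact le_trans (by omega) (Nat.le_mul_of_pos_right (q + 1) hpos)
  classical
  rw [coeff_levelSeries_eq _ ((range P.length).image (rotWord P q)) (fun w => by
      rw [isRotated_wordPow_iff hP, Finset.mem_image]
      simp only [Finset.mem_range, eq_comm]) hlen,
    Finset.sum_image (rotWord_injOn huniq q)]
  obtain ⟨E, hE⟩ := ha q (by omega)
  set T := ∑ r ∈ range P.length, wordPoly (rotWord P q r) with hT
  have hmul : (((1 - X) * T : ℤ[X]) : PowerSeries ℤ) =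
      V * (((1 - X) * N : ℤ[X]) : PowerSeries ℤ) +
        PowerSeries.X ^ (i + 1) * (V * (((1 - X) * E : ℤ[X]) : PowerSeries ℤ)) := by
    have h1 : (1 - X) * (D * T) = (1 - X) * N + X ^ (i + 1) * ((1 - X) * E) := by
      linear_combination (1 - X) * hE
    have h2 := congrArg (fun p : ℤ[X] => (p : PowerSeries ℤ)) h1
    simp only [Polynomial.coe_mul, Polynomial.coe_add, Polynomial.coe_pow, Polynomial.coe_X] at h2 ⊢
    linear_combination V * h2 -
      ((1 - X : ℤ[X]) : PowerSeries ℤ) * (T : PowerSeries ℤ) * hV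
  rw [← Polynomial.coeff_coe, hmul, map_add, PowerSeries.coeff_X_pow_mul', if_neg (by omega),
    add_zero]

lemma HasRationalLimit.const (D p : ℤ[X]) : HasRationalLimit D fun _ => p :=
  ⟨D * p, fun i => Eventually.of_forall fun q => by simp⟩

lemma HasRationalLimit.add {D : ℤ[X]} {u v : ℕ → ℤ[X]} (hu : HasRationalLimit D u)
    (hv : HasRationalLimit D v) : HasRationalLimit D fun q => u q + v q := by
  obtain ⟨M, hM⟩ := hu
  obtain ⟨N, hN⟩ := hv
  refine ⟨M + N, fun i => ?_⟩
  filter_upwards [hM i, hN i] with q h1 h2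
  have := dvd_add h1 h2
  convert this using 1
  ring

lemma HasRationalLimit.mul_left {D : ℤ[X]} {u : ℕ → ℤ[X]} (hu : HasRationalLimit D u)
    (p : ℤ[X]) : HasRationalLimit D fun q => p * u q := by
  obtain ⟨M, hM⟩ := hu
  refine ⟨p * M, fun i => ?_⟩
  filter_upwards [hM i] with q h1
  have := h1.mul_left p
  convert this using 1
  ring

lemma HasRationalLimit.sum {D : ℤ[X]} {ι : Type*} (s : Finset ι) {u : ι → ℕ → ℤ[X]}
    (hu : ∀ i ∈ s, HasRationalLimit D (u i)) : HasRationalLimit D fun q => ∑ i ∈ s, u i q := by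
  classical
  induction s using Finset.induction_on with
  | empty => simpa using HasRationalLimit.const D 0
  | insert a s ha ih =>
    simp_rw [Finset.sum_insert ha]
    exact (hu a (Finset.mem_insert_self a s)).add
      (ih fun i hi => hu i (Finset.mem_insert_of_mem hi))

lemma HasRationalLimit.of_succ {D : ℤ[X]} {u : ℕ → ℤ[X]}
    (h : HasRationalLimit D fun q => u (q + 1)) : HasRationalLimit D u := by
  obtain ⟨N, hN⟩ := h
  refine ⟨N, fun i => ?_⟩
  obtain ⟨a, ha⟩ := eventually_atTop.1 (hN i)
  refine eventually_atTop.2 ⟨a + 1, fun q hq => ?_⟩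
  obtain ⟨q, rfl⟩ : ∃ q', q = q' + 1 := ⟨q - 1, by omega⟩
  exact ha q (by omega)

lemma HasRationalLimit.of_rec {e f : ℤ[X]} {z : ℕ → ℤ[X]} (hf : X ∣ f)
    (hz : ∀ q, z (q + 1) = e + f * z q) : HasRationalLimit (1 - f) z := by
  have key : ∀ q, X ^ q ∣ (1 - f) * z q - e := by
    intro q
    induction q with
    | zero => simp
    | succ q ih =>
      have := mul_dvd_mul hf ih
      rw [pow_succ', hz]
      convert this using 1
      ring
  exact ⟨e, fun i => eventually_atTop.2 ⟨i, fun q hq => (pow_dvd_pow X hq).trans (key q)⟩⟩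

/-! ### Splitting off the aperiodic ends of the list of multiplicities -/

lemma HasRationalLimit.insertionPoly_append {D : ℤ[X]} {L : ℕ → List ℕ}
    (hL : ∀ a b, HasRationalLimit D fun q => insertionPoly 0 (L q) a b) (A : List ℕ) (a b : ℕ) :
    HasRationalLimit D fun q => insertionPoly 0 (A ++ L q) a b := by
  induction A generalizing a b with
  | nil => exact hL a b
  | cons m A ih =>
    simp_rw [List.cons_append, insertionPoly_cons]
    exact HasRationalLimit.sum _ fun c _ => (ih b c).mul_left _

lemma pairMults_append (b : Bead) (u v : List Bead) :
    pairMults b (u ++ v) = pairMults b u ++ pairMults (u.getLastD b) v := by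
  induction u generalizing b with
  | nil => rfl
  | cons c u ih =>
    rw [List.cons_append, pairMults, pairMults, ih, List.getLastD_cons, List.cons_append]

lemma pairMults_wordPow_append {P : List Bead} {b : Bead} (hb : P.getLastD b = b) (q : ℕ)
    (v : List Bead) :
    pairMults b (wordPow P q ++ v) =
      (List.replicate q (pairMults b P)).flatten ++ pairMults b v := by
  induction q with
  | zero => simp [wordPow]
  | succ q ih =>
    rw [wordPow_succ, List.append_assoc, pairMults_append, hb, ih, List.replicate_succ,
      List.flatten_cons, List.append_assoc]

/-- The slot at the front is absorbed into the number of entries just above the first values. -/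
lemma wordPoly_cons (b : Bead) (w : List Bead) :
    wordPoly (b :: w) = if (b :: w).getLast? = some Bead.B
      then insertionPoly 0 (wordMults (b :: w)) 0 1
      else ∑ c ∈ range ((if b = Bead.B then 1 else 0) + 1),
        X ^ c * insertionPoly 0 (pairMults b w) 0 (c + 1) := by
  rw [wordPoly]
  split_ifs with h1
  · exact insertionPoly_two _ _ _
  all_goals
    rw [wordMults, insertionPoly_cons]
    simp [insertionPoly_two, *]

lemma hasRationalLimit_wordPoly {D : ℤ[X]} {b : Bead} {w : ℕ → List Bead}
    (h : ∀ a c, HasRationalLimit D fun q => insertionPoly 0 (pairMults b (w q)) a c)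
    {o : Option Bead} (ho : ∀ q, (b :: w q).getLast? = o) :
    HasRationalLimit D fun q => wordPoly (b :: w q) := by
  simp_rw [wordPoly_cons, ho]
  split_ifs
  · exact HasRationalLimit.insertionPoly_append h [_] 0 1
  all_goals exact HasRationalLimit.sum _ fun c _ => (h 0 (c + 1)).mul_left _

/-- It suffices to treat a pure power of the block of multiplicities of `P`, with an arbitrary end
`t` and arbitrary initial states `a`, `b`. -/
lemma hasRationalLimit_rotWord {D : ℤ[X]} {P : List Bead} {l : Bead} (hl : P.getLast? = some l)
    (hD : ∀ (t : List ℕ) (a b : ℕ), HasRationalLimit D fun q =>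
      insertionPoly 0 ((List.replicate q (pairMults l P)).flatten ++ t) a b)
    {r : ℕ} (hr : r < P.length) :
    HasRationalLimit D fun q => wordPoly (rotWord P q r) := by
  have hdrop : P.drop r = P[r] :: P.drop (r + 1) := List.drop_eq_getElem_cons hr
  have hPl : P.getLastD l = l := by rw [List.getLastD_eq_getLast?, hl]; rfl
  have hlast : (P.drop (r + 1)).getLastD P[r] = l := by
    have h1 : (P.drop r).getLast? = some l := by
      rw [List.getLast?_drop, if_neg (by omega), hl]
    rw [hdrop, List.getLast?_cons] at h1
    rw [List.getLastD_eq_getLast?]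
    exact Option.some_injective _ h1
  apply HasRationalLimit.of_succ
  simp only [rotWord, hdrop, List.cons_append]
  refine hasRationalLimit_wordPoly (o := (P ++ P.take r).getLast?) ?_ ?_
  · intro a c
    simp_rw [pairMults_append _ (P.drop (r + 1)), hlast, pairMults_wordPow_append hPl]
    refine HasRationalLimit.insertionPoly_append (fun a b => ?_) _ a c
    obtain ⟨N, hN⟩ := hD (pairMults l (P.take r)) a b
    exact ⟨N, fun i => (tendsto_add_atTop_nat 1).eventually (hN i)⟩
  · intro q
    have hne : P ++ P.take r ≠ [] := by
      intro h
      rw [(List.append_eq_nil_iff.1 h).1] at hr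
      simp at hr
    rw [wordPow_succ', ← List.cons_append, ← List.append_assoc, ← List.append_assoc,
      List.append_assoc (_ ++ _), List.getLast?_append_of_ne_nil _ hne]

/-! ### Transfer through a run of simple values -/

/-- The transfer through `n` values of multiplicity one, applied to a function `φ` of the numbers of
entries with the last two values. -/
noncomputable def onesTransfer : ℕ → (ℕ → ℕ → ℤ[X]) → ℕ → ℕ → ℤ[X]
  | 0, φ, a, b => φ a b
  | n + 1, φ, a, b => onesTransfer n φ b 0 + ((a + b : ℕ) : ℤ[X]) * X * onesTransfer n φ b 1

lemma insertionPoly_ones_append (n : ℕ) (L : List ℕ) (a b : ℕ) :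
    insertionPoly 0 (List.replicate n 1 ++ L) a b = onesTransfer n (insertionPoly 0 L) a b := by
  induction n generalizing a b with
  | zero => rfl
  | succ n ih =>
    rw [List.replicate_succ, List.cons_append, insertionPoly_cons, onesTransfer]
    simp [Finset.sum_range_succ, ih, Nat.multichoose_one_right]

lemma insertionPoly_zero_cons (L : List ℕ) (a b : ℕ) :
    insertionPoly 0 (0 :: L) a b = insertionPoly 0 L b 0 := by
  simp [insertionPoly_cons]

lemma insertionPoly_one_cons (L : List ℕ) (a b : ℕ) :
    insertionPoly 0 (1 :: L) a b =
      insertionPoly 0 L b 0 + ((a + b : ℕ) : ℤ[X]) * X * insertionPoly 0 L b 1 := by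
  simp [insertionPoly_cons, Finset.sum_range_succ, Nat.multichoose_one_right]

lemma insertionPoly_two_cons (L : List ℕ) (a b : ℕ) :
    insertionPoly 0 (2 :: L) a b =
      insertionPoly 0 L b 0 + ((a + b : ℕ) : ℤ[X]) * X * insertionPoly 0 L b 1 +
        (Nat.multichoose (a + b) 2 : ℤ[X]) * X ^ 2 * insertionPoly 0 L b 2 := by
  simp [insertionPoly_cons, Finset.sum_range_succ, Nat.multichoose_one_right]

lemma onesTransfer_add_mul (n : ℕ) (φ ψ : ℕ → ℕ → ℤ[X]) (z : ℤ[X]) (a b : ℕ) :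
    onesTransfer n (fun a b => φ a b + ψ a b * z) a b =
      onesTransfer n φ a b + onesTransfer n ψ a b * z := by
  induction n generalizing a b with
  | zero => rfl
  | succ n ih =>
    simp only [onesTransfer, ih]
    ring

/-- After a value of multiplicity one, the second argument of `φ` is `0` or `1`. -/
lemma onesTransfer_congr {n : ℕ} {φ ψ : ℕ → ℕ → ℤ[X]} (h0 : ∀ a, φ a 0 = ψ a 0)
    (h1 : ∀ a, φ a 1 = ψ a 1) (a b : ℕ) :
    onesTransfer (n + 1) φ a b = onesTransfer (n + 1) ψ a b := by
  induction n generalizing a b with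
  | zero => simp only [onesTransfer, h0, h1]
  | succ n ih =>
    have step : ∀ χ, onesTransfer (n + 1 + 1) χ a b = onesTransfer (n + 1) χ b 0 +
        ((a + b : ℕ) : ℤ[X]) * X * onesTransfer (n + 1) χ b 1 := fun _ => rfl
    rw [step, step, ih, ih]

lemma onesTransfer_zero_zero {φ : ℕ → ℕ → ℤ[X]} (h : φ 0 0 = 0) (n : ℕ) :
    onesTransfer n φ 0 0 = 0 := by
  induction n with
  | zero => exact h
  | succ n ih => simp [onesTransfer, ih]

/-! ### The periodic blocks for at least two equal beads -/

/-- The weight of a passage through the multiplicities `2, 0, 1` in which the last value is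
chosen. -/
noncomputable def blockBW (a b : ℕ) : ℤ[X] :=
  X * (((a + b : ℕ) : ℤ[X]) * X + 2 * (Nat.multichoose (a + b) 2 : ℤ[X]) * X ^ 2)

lemma X_dvd_onesTransfer {φ : ℕ → ℕ → ℤ[X]} (h : ∀ a b, X ∣ φ a b) (n a b : ℕ) :
    X ∣ onesTransfer n φ a b := by
  induction n generalizing a b with
  | zero => exact h a b
  | succ n ih => exact dvd_add (ih _ _) ((ih _ _).mul_left _)

/-- The transfer through one period `1, …, 1, 2, 0, 1` of `B W ^ (n + 2)`, from chosen last value to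
chosen last value. -/
noncomputable def loopBW (n : ℕ) : ℤ[X] := onesTransfer n blockBW 0 1

/-- The transfer through one period `2, 1, …, 1, 0` of `W B ^ (n + 2)`, from chosen last value
of multiplicity one to the next such value. -/
noncomputable def loopWB (n : ℕ) : ℤ[X] :=
  X * onesTransfer (n + 1) (fun _ b => (b : ℤ[X])) 0 1 +
    X ^ 2 * onesTransfer (n + 1) (fun _ b => (b : ℤ[X])) 0 2

/-- Only the case that the last of the multiplicities `2, 0, 1` is used leads on to the next
values, and it does so from the state `(0, 1)`. -/
lemma insertionPoly_blockBW (n : ℕ) (L : List ℕ) (a b : ℕ) :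
    insertionPoly 0 (2 :: 0 :: 1 :: (List.replicate n 1 ++ L)) a b =
      (1 + ((a + b : ℕ) : ℤ[X]) * X + (Nat.multichoose (a + b) 2 : ℤ[X]) * X ^ 2) +
        blockBW a b * insertionPoly 0 (List.replicate n 1 ++ L) 0 1 := by
  rw [insertionPoly_two_cons]
  simp only [insertionPoly_zero_cons, insertionPoly_one_cons, insertionPoly_zero_zero, blockBW]
  push_cast
  ring

lemma hasRationalLimit_BW {n : ℕ} {L : ℕ → List ℕ}
    (hL : ∀ q, L (q + 1) = 2 :: 0 :: 1 :: (List.replicate n 1 ++ L q)) (a b : ℕ) :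
    HasRationalLimit (1 - loopBW n) fun q => insertionPoly 0 (L q) a b := by
  have hexp : ∀ q a b, insertionPoly 0 (L (q + 1)) a b = _ := fun q a b => by
    rw [hL q, insertionPoly_blockBW n (L q) a b]
  have hlim : HasRationalLimit (1 - loopBW n)
      fun q => insertionPoly 0 (List.replicate n 1 ++ L q) 0 1 := by
    refine HasRationalLimit.of_rec (e := onesTransfer n (fun a b =>
      1 + ((a + b : ℕ) : ℤ[X]) * X + (Nat.multichoose (a + b) 2 : ℤ[X]) * X ^ 2) 0 1)
      (X_dvd_onesTransfer (fun a b => dvd_mul_right _ _) n 0 1) fun q => ?_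
    have h1 : insertionPoly 0 (L (q + 1)) = fun a b =>
        (1 + ((a + b : ℕ) : ℤ[X]) * X + (Nat.multichoose (a + b) 2 : ℤ[X]) * X ^ 2) +
          blockBW a b * insertionPoly 0 (List.replicate n 1 ++ L q) 0 1 := by
      funext a b
      exact hexp q a b
    rw [insertionPoly_ones_append n (L (q + 1)), h1, onesTransfer_add_mul, loopBW]
  apply HasRationalLimit.of_succ
  simp_rw [hexp]
  exact (HasRationalLimit.const _ _).add (hlim.mul_left _)

/-- Regrouping of a power: `(x A) ^ (q + 1) = x (A x) ^ q A`. -/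
lemma replicate_flatten_rotate (x : ℕ) (A : List ℕ) (q : ℕ) (t : List ℕ) :
    (List.replicate (q + 1) (x :: A)).flatten ++ t =
      x :: ((List.replicate q (A ++ [x])).flatten ++ (A ++ t)) := by
  induction q with
  | zero => simp
  | succ q ih =>
    rw [List.replicate_succ, List.flatten_cons, List.append_assoc, ih,
      List.replicate_succ (n := q), List.flatten_cons]
    simp

/-- After a run of simple values and a gap, the sequence goes on only if the last value of
the run is used, and then from the state `(1, 0)`. -/
lemma insertionPoly_ones_zero_append (n : ℕ) (L : List ℕ) (a b : ℕ) :
    insertionPoly 0 (List.replicate (n + 1) 1 ++ (0 :: L)) a b =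
      onesTransfer (n + 1) (fun _ b => 1 - (b : ℤ[X])) a b +
        onesTransfer (n + 1) (fun _ b => (b : ℤ[X])) a b * insertionPoly 0 L 1 0 := by
  rw [insertionPoly_ones_append, ← onesTransfer_add_mul]
  refine onesTransfer_congr (fun a => ?_) (fun a => ?_) a b
  · simp [insertionPoly_zero_cons, insertionPoly_zero_zero]
  · simp [insertionPoly_zero_cons]

lemma hasRationalLimit_WB {n : ℕ} {L : ℕ → List ℕ}
    (hL : ∀ q, L (q + 1) = 2 :: (List.replicate (n + 1) 1 ++ (0 :: L q))) (b : ℕ) :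
    HasRationalLimit (1 - loopWB n) fun q => insertionPoly 0 (L q) b 0 := by
  have hexp : ∀ q b, insertionPoly 0 (L (q + 1)) b 0 =
      (1 + (b : ℤ[X]) * X * onesTransfer (n + 1) (fun _ b => 1 - (b : ℤ[X])) 0 1 +
        (Nat.multichoose b 2 : ℤ[X]) * X ^ 2 *
          onesTransfer (n + 1) (fun _ b => 1 - (b : ℤ[X])) 0 2) +
      ((b : ℤ[X]) * X * onesTransfer (n + 1) (fun _ b => (b : ℤ[X])) 0 1 +
        (Nat.multichoose b 2 : ℤ[X]) * X ^ 2 *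
          onesTransfer (n + 1) (fun _ b => (b : ℤ[X])) 0 2) * insertionPoly 0 (L q) 1 0 := by
    intro q b
    rw [hL, insertionPoly_two_cons, insertionPoly_zero_zero, insertionPoly_ones_zero_append,
      insertionPoly_ones_zero_append, add_zero]
    ring
  have hlim : HasRationalLimit (1 - loopWB n) fun q => insertionPoly 0 (L q) 1 0 := by
    refine HasRationalLimit.of_rec
      (e := 1 + X * onesTransfer (n + 1) (fun _ b => 1 - (b : ℤ[X])) 0 1 +
        X ^ 2 * onesTransfer (n + 1) (fun _ b => 1 - (b : ℤ[X])) 0 2)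
      (dvd_add (dvd_mul_right _ _) ((dvd_pow_self X two_ne_zero).mul_right _)) fun q => ?_
    have h1 := hexp q 1
    rw [Nat.multichoose_one, Nat.cast_one, one_mul, one_mul] at h1
    exact h1
  apply HasRationalLimit.of_succ
  simp_rw [hexp]
  exact (HasRationalLimit.const _ _).add (hlim.mul_left _)

/-- The Cayley–Hamilton relation of the transfer matrix of a value of multiplicity one on the states
`(0, 1)`, `(1, 1)` and `(1, 0)`. -/
lemma linear_rec_of_transfer {p q r : ℕ → ℤ[X]} (hp : ∀ n, p (n + 1) = r n + X * q n)
    (hq : ∀ n, q (n + 1) = r n + 2 * X * q n) (hr : ∀ n, r (n + 1) = X * p n) (n : ℕ) :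
    p (n + 3) = 2 * X * p (n + 2) + X * p (n + 1) - X ^ 2 * p n ∧
    q (n + 3) = 2 * X * q (n + 2) + X * q (n + 1) - X ^ 2 * q n ∧
    r (n + 3) = 2 * X * r (n + 2) + X * r (n + 1) - X ^ 2 * r n := by
  refine ⟨?_, ?_, ?_⟩ <;>
  · simp only [hp, hq, hr]
    ring

lemma onesTransfer_rec {φ : ℕ → ℕ → ℤ[X]} (h : φ 0 0 = 0) :
    (∀ n, onesTransfer (n + 1) φ 0 1 = onesTransfer n φ 1 0 + X * onesTransfer n φ 1 1) ∧
    (∀ n, onesTransfer (n + 1) φ 1 1 = onesTransfer n φ 1 0 + 2 * X * onesTransfer n φ 1 1) ∧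
    (∀ n, onesTransfer (n + 1) φ 1 0 = X * onesTransfer n φ 0 1) := by
  refine ⟨fun n => ?_, fun n => ?_, fun n => ?_⟩
  · simp [onesTransfer]
  · simp [onesTransfer]
  · simp [onesTransfer, onesTransfer_zero_zero h]

/-- The two families of words have the same denominators: `loopBW` satisfies the recurrence of
order three from the start and `loopWB` from index `1` on, since it is a fixed combination of the
transfers from the states `(0, 1)`, `(1, 1)` and `(1, 0)`. -/
lemma loopWB_eq_loopBW (n : ℕ) : loopWB n = loopBW n := by
  have hBW : ∀ n, loopBW (n + 3) =
      2 * X * loopBW (n + 2) + X * loopBW (n + 1) - X ^ 2 * loopBW n := fun n => by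
    obtain ⟨hp, hq, hr⟩ := onesTransfer_rec (φ := blockBW) (by simp [blockBW])
    exact (linear_rec_of_transfer (p := fun n => onesTransfer n blockBW 0 1)
      (q := fun n => onesTransfer n blockBW 1 1) (r := fun n => onesTransfer n blockBW 1 0)
      hp hq hr n).1
  have hWB : ∀ n, loopWB (n + 4) =
      2 * X * loopWB (n + 3) + X * loopWB (n + 2) - X ^ 2 * loopWB (n + 1) := fun n => by
    let φ : ℕ → ℕ → ℤ[X] := fun _ b => (b : ℤ[X])
    have h0 : φ 0 0 = 0 := by simp [φ]
    obtain ⟨hp, hq, hr⟩ := onesTransfer_rec h0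
    -- Two steps lead from the state `(0, 2)` to the three states that the recurrence covers.
    have hw : ∀ m, onesTransfer (m + 2) φ 0 2 = 2 * X * onesTransfer m φ 0 1 +
        2 * X * (onesTransfer m φ 1 0 + 3 * X * onesTransfer m φ 1 1) := fun m => by
      simp [onesTransfer, onesTransfer_zero_zero h0]
    have hl : ∀ m, loopWB (m + 1) = X * onesTransfer (m + 2) φ 0 1 +
        X ^ 2 * (2 * X * onesTransfer m φ 0 1 +
        2 * X * (onesTransfer m φ 1 0 + 3 * X * onesTransfer m φ 1 1)) := fun m => by
      rw [← hw]
      rfl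
    obtain ⟨h1, h2, h3⟩ := linear_rec_of_transfer (p := fun n => onesTransfer n φ 0 1)
      (q := fun n => onesTransfer n φ 1 1) (r := fun n => onesTransfer n φ 1 0) hp hq hr n
    obtain ⟨h4, -, -⟩ := linear_rec_of_transfer (p := fun n => onesTransfer n φ 0 1)
      (q := fun n => onesTransfer n φ 1 1) (r := fun n => onesTransfer n φ 1 0) hp hq hr (n + 2)
    rw [hl (n + 3), hl (n + 2), hl (n + 1), hl n]
    linear_combination X * h4 + 2 * X ^ 3 * h1 + 2 * X ^ 3 * h3 + 6 * X ^ 4 * h2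
  have hbase : ∀ m < 4, loopWB m = loopBW m := by
    intro m hm
    interval_cases m <;>
    · simp [loopWB, loopBW, onesTransfer, blockBW, Nat.multichoose_eq]
      ring
  induction n using Nat.strong_induction_on with
  | _ n ih =>
    by_cases hn : n < 4
    · exact hbase n hn
    · obtain ⟨m, rfl⟩ : ∃ m, n = m + 4 := ⟨n - 4, by omega⟩
      rw [hWB m, hBW (m + 1), ih (m + 3) (by omega), ih (m + 2) (by omega), ih (m + 1) (by omega)]

/-- The top coefficients stay positive, as the sequences that use every value contribute to
them. -/
lemma onesTransfer_blockBW_degree (n : ℕ) :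
    ((onesTransfer n blockBW 0 1).natDegree ≤ n + 3 ∧
      0 < (onesTransfer n blockBW 0 1).coeff (n + 3)) ∧
    ((onesTransfer n blockBW 1 1).natDegree ≤ n + 3 ∧
      0 < (onesTransfer n blockBW 1 1).coeff (n + 3)) ∧
    (onesTransfer n blockBW 1 0).natDegree ≤ n + 3 := by
  obtain ⟨hp, hq, hr⟩ := onesTransfer_rec (φ := blockBW) (by simp [blockBW])
  induction n with
  | zero =>
    have h01 : onesTransfer 0 blockBW 0 1 = 2 * X ^ 3 + X ^ 2 := by
      simp [onesTransfer, blockBW, Nat.multichoose_eq]; ring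
    have h10 : onesTransfer 0 blockBW 1 0 = 2 * X ^ 3 + X ^ 2 := by
      simp [onesTransfer, blockBW, Nat.multichoose_eq]; ring
    have h11 : onesTransfer 0 blockBW 1 1 = 6 * X ^ 3 + 2 * X ^ 2 := by
      simp [onesTransfer, blockBW, Nat.multichoose_two]; ring
    rw [h01, h10, h11]
    refine ⟨⟨by compute_degree, ?_⟩, ⟨by compute_degree, ?_⟩, by compute_degree⟩
    · have : ((2 * X ^ 3 + X ^ 2 : ℤ[X])).coeff (0 + 3) = 2 := by compute_degree!
      omega
    · have : ((6 * X ^ 3 + 2 * X ^ 2 : ℤ[X])).coeff (0 + 3) = 6 := by compute_degree!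
      omega
  | succ n ih =>
    obtain ⟨⟨p1, p2⟩, ⟨q1, q2⟩, r1⟩ := ih
    have hX : ∀ s : ℤ[X], s.natDegree ≤ n + 3 → (X * s).natDegree ≤ n + 1 + 3 := fun s hs =>
      (Polynomial.natDegree_mul_le).trans (by have := Polynomial.natDegree_X_le (R := ℤ); omega)
    have hr0 : (onesTransfer n blockBW 1 0).coeff (n + 1 + 3) = 0 :=
      Polynomial.coeff_eq_zero_of_natDegree_lt (by omega)
    have e : n + 1 + 3 = (n + 3) + 1 := by omega
    have hq' : onesTransfer (n + 1) blockBW 1 1 = onesTransfer n blockBW 1 0 +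
        (X * onesTransfer n blockBW 1 1 + X * onesTransfer n blockBW 1 1) := by
      rw [hq]; ring
    have hXc : (X * onesTransfer n blockBW 1 1).coeff (n + 1 + 3) =
        (onesTransfer n blockBW 1 1).coeff (n + 3) := by rw [e, Polynomial.coeff_X_mul]
    refine ⟨⟨?_, ?_⟩, ⟨?_, ?_⟩, ?_⟩
    · rw [hp]
      exact Polynomial.natDegree_add_le_of_degree_le (by omega) (hX _ q1)
    · rw [hp, Polynomial.coeff_add, hr0, hXc]
      omega
    · rw [hq']
      exact Polynomial.natDegree_add_le_of_degree_le (by omega)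
        (Polynomial.natDegree_add_le_of_degree_le (hX _ q1) (hX _ q1))
    · rw [hq', Polynomial.coeff_add, Polynomial.coeff_add, hr0, hXc]
      omega
    · rw [hr]
      exact hX _ p1

lemma natDegree_one_sub_loopBW (n : ℕ) : (1 - loopBW n).natDegree = n + 3 := by
  obtain ⟨⟨h1, h2⟩, -⟩ := onesTransfer_blockBW_degree n
  refine Polynomial.natDegree_eq_of_le_of_coeff_ne_zero ?_ ?_
  · exact (Polynomial.natDegree_sub_le _ _).trans (by simpa [loopBW] using h1)
  · rw [Polynomial.coeff_sub, Polynomial.coeff_one, if_neg (by omega)]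
    have : 0 < (loopBW n).coeff (n + 3) := h2
    omega

lemma coeff_zero_one_sub_loopBW (n : ℕ) : (1 - loopBW n).coeff 0 = 1 := by
  have h : X ∣ loopBW n := X_dvd_onesTransfer (fun a b => dvd_mul_right _ _) n 0 1
  rw [Polynomial.coeff_sub, Polynomial.X_dvd_iff.1 h]
  simp

/-! ### The period of two alternating beads -/

/-- The determinant of `1 - A`, where `A` is the transfer matrix through the multiplicities `2, 0`
on the states `(1, 0)` and `(2, 0)`. -/
noncomputable def denomOne : ℤ[X] := 1 - X - 3 * X ^ 2 + X ^ 3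

lemma hasRationalLimit_two_zero {L : ℕ → List ℕ} (hL : ∀ q, L (q + 1) = 2 :: 0 :: L q)
    (a b : ℕ) : HasRationalLimit denomOne fun q => insertionPoly 0 (L q) a b := by
  have hrec : ∀ a b q, insertionPoly 0 (L (q + 1)) a b =
      1 + ((a + b : ℕ) : ℤ[X]) * X * insertionPoly 0 (L q) 1 0 +
        (Nat.multichoose (a + b) 2 : ℤ[X]) * X ^ 2 * insertionPoly 0 (L q) 2 0 := fun a b q => by
    rw [hL q, insertionPoly_two_cons]
    simp only [insertionPoly_zero_cons, insertionPoly_zero_zero]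
  have h1 : ∀ q, insertionPoly 0 (L (q + 1)) 1 0 =
      1 + X * insertionPoly 0 (L q) 1 0 + X ^ 2 * insertionPoly 0 (L q) 2 0 := fun q => by
    rw [hrec]; simp
  have h2 : ∀ q, insertionPoly 0 (L (q + 1)) 2 0 =
      1 + 2 * X * insertionPoly 0 (L q) 1 0 + 3 * X ^ 2 * insertionPoly 0 (L q) 2 0 := fun q => by
    rw [hrec, add_zero, Nat.multichoose_two]; norm_num
  -- The numerators are the adjugate of `1 - A`, applied to the vector `(1, 1)`.
  have key : ∀ q, X ^ q ∣ denomOne * insertionPoly 0 (L q) 1 0 - (1 - 2 * X ^ 2) ∧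
      X ^ q ∣ denomOne * insertionPoly 0 (L q) 2 0 - (1 + X) := by
    intro q
    induction q with
    | zero => simp
    | succ q ih =>
      obtain ⟨⟨s, hs⟩, ⟨s', hs'⟩⟩ := ih
      refine ⟨⟨s + X * s', ?_⟩, ⟨2 * s + 3 * X * s', ?_⟩⟩
      · rw [h1]
        simp only [denomOne] at *
        linear_combination X * hs + X ^ 2 * hs'
      · rw [h2]
        simp only [denomOne] at *
        linear_combination 2 * X * hs + 3 * X ^ 2 * hs'
  have hV1 : HasRationalLimit denomOne fun q => insertionPoly 0 (L q) 1 0 :=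
    ⟨_, fun i => eventually_atTop.2 ⟨i, fun q hq => (pow_dvd_pow X hq).trans (key q).1⟩⟩
  have hV2 : HasRationalLimit denomOne fun q => insertionPoly 0 (L q) 2 0 :=
    ⟨_, fun i => eventually_atTop.2 ⟨i, fun q hq => (pow_dvd_pow X hq).trans (key q).2⟩⟩
  apply HasRationalLimit.of_succ
  simp_rw [hrec]
  exact ((HasRationalLimit.const _ _).add (hV1.mul_left _)).add (hV2.mul_left _)

/-- A block that starts with a gap may be cut behind the gap instead of before it. -/
lemma HasRationalLimit.of_zero_cons {D : ℤ[X]} {A t : List ℕ}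
    (h : ∀ b, HasRationalLimit D fun q =>
      insertionPoly 0 ((List.replicate q (A ++ [0])).flatten ++ (A ++ t)) b 0) (a b : ℕ) :
    HasRationalLimit D fun q =>
      insertionPoly 0 ((List.replicate q (0 :: A)).flatten ++ t) a b := by
  apply HasRationalLimit.of_succ
  simp_rw [replicate_flatten_rotate, insertionPoly_zero_cons]
  exact h b

/-! ### The two families of words -/

theorem exists_limits_of_denominator {k : ℕ} (hk : 1 ≤ k) {D : ℤ[X]} (hD : D.coeff 0 = 1)
    (h1 : ∀ (t : List ℕ) (a b : ℕ), HasRationalLimit D fun q => insertionPoly 0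
      ((List.replicate q (pairMults Bead.W (wordBW k))).flatten ++ t) a b)
    (h2 : ∀ (t : List ℕ) (a b : ℕ), HasRationalLimit D fun q => insertionPoly 0
      ((List.replicate q (pairMults Bead.B (wordWB k))).flatten ++ t) a b) :
    ∃ H₁ H₂ : PowerSeries ℤ, IsLimitSeries (wordBW k) H₁ ∧ IsLimitSeries (wordWB k) H₂ ∧
      ∃ N₁ N₂ : ℤ[X], (D : PowerSeries ℤ) * H₁ = (N₁ : PowerSeries ℤ) ∧
        (D : PowerSeries ℤ) * H₂ = (N₂ : PowerSeries ℤ) := by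
  obtain ⟨m, rfl⟩ : ∃ m, k = m + 1 := ⟨k - 1, by omega⟩
  obtain ⟨H₁, N₁, hH₁, hN₁⟩ := exists_isLimitSeries (P := wordBW (m + 1)) (D := D)
    (by simp [wordBW]) (by
      intro i hi h
      rcases i with _ | i
      · rfl
      · simp [wordBW] at h) hD
    (HasRationalLimit.sum _ fun r hr => hasRationalLimit_rotWord (l := Bead.W)
      (by rw [wordBW, List.replicate_succ', ← List.cons_append, List.getLast?_concat]) h1
      (Finset.mem_range.1 hr))
  obtain ⟨H₂, N₂, hH₂, hN₂⟩ := exists_isLimitSeries (P := wordWB (m + 1)) (D := D)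
    (by simp [wordWB]) (by
      intro i hi h
      rcases i with _ | i
      · rfl
      · simp [wordWB] at h) hD
    (HasRationalLimit.sum _ fun r hr => hasRationalLimit_rotWord (l := Bead.B)
      (by rw [wordWB, List.replicate_succ', ← List.cons_append, List.getLast?_concat]) h2
      (Finset.mem_range.1 hr))
  exact ⟨H₁, H₂, hH₁, hH₂, N₁, N₂, hN₁, hN₂⟩

lemma pairMults_replicate (b : Bead) (n : ℕ) :
    pairMults b (List.replicate n b) = List.replicate n 1 := by
  induction n with
  | zero => rfl
  | succ n ih => cases b <;> simp [List.replicate_succ, pairMults, ih]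

end Bulgarian

open Bulgarian in
theorem theorem1p3 (k : ℕ) (hk : 1 ≤ k) :
    ∃ H₁ H₂ : PowerSeries ℤ,
      Bulgarian.IsLimitSeries (Bulgarian.wordBW k) H₁ ∧
      Bulgarian.IsLimitSeries (Bulgarian.wordWB k) H₂ ∧
      ∃ D N₁ N₂ : Polynomial ℤ,
        D.coeff 0 ≠ 0 ∧
        (2 ≤ k → D.natDegree = k + 1) ∧
        (k = 1 → D.natDegree = 3) ∧
        (D : PowerSeries ℤ) * H₁ = (N₁ : PowerSeries ℤ) ∧
        (D : PowerSeries ℤ) * H₂ = (N₂ : PowerSeries ℤ) := by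
  rcases Nat.lt_or_ge 1 k with h | h
  · obtain ⟨n, rfl⟩ : ∃ n, k = n + 2 := ⟨k - 2, by omega⟩
    have hD := coeff_zero_one_sub_loopBW n
    have hBW : pairMults Bead.W (wordBW (n + 2)) = 2 :: 0 :: 1 :: List.replicate n 1 := by
      simp [wordBW, pairMults, List.replicate_succ, pairMults_replicate]
    have hWB : pairMults Bead.B (wordWB (n + 2)) = 0 :: 2 :: List.replicate (n + 1) 1 := by
      simp [wordWB, pairMults, List.replicate_succ, pairMults_replicate]
    obtain ⟨H₁, H₂, hH₁, hH₂, N₁, N₂, hN₁, hN₂⟩ := exists_limits_of_denominator hk hD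
      (fun t => by
        rw [hBW]
        exact hasRationalLimit_BW fun q => by simp [List.replicate_succ])
      (fun t => by
        rw [hWB, ← loopWB_eq_loopBW]
        exact HasRationalLimit.of_zero_cons
          (hasRationalLimit_WB fun q => by simp [List.replicate_succ]))
    exact ⟨H₁, H₂, hH₁, hH₂, 1 - loopBW n, N₁, N₂, by rw [hD]; exact one_ne_zero,
      fun _ => natDegree_one_sub_loopBW n, fun h => by omega, hN₁, hN₂⟩
  · obtain rfl : k = 1 := by omega
    have hD : denomOne.coeff 0 = 1 := by
      simp [denomOne, Polynomial.coeff_zero_eq_eval_zero]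
    have hBW : pairMults Bead.W (wordBW 1) = [2, 0] := by simp [wordBW, pairMults]
    have hWB : pairMults Bead.B (wordWB 1) = [0, 2] := by simp [wordWB, pairMults]
    obtain ⟨H₁, H₂, hH₁, hH₂, N₁, N₂, hN₁, hN₂⟩ := exists_limits_of_denominator hk hD
      (fun t => by
        rw [hBW]
        exact hasRationalLimit_two_zero fun q => by simp [List.replicate_succ])
      (fun t => by
        rw [hWB]
        exact HasRationalLimit.of_zero_cons fun b =>
          hasRationalLimit_two_zero (fun q => by simp [List.replicate_succ]) b 0)
    refine ⟨H₁, H₂, hH₁, hH₂, denomOne, N₁, N₂, by rw [hD]; exact one_ne_zero,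
      fun h => by omega, fun _ => ?_, hN₁, hN₂⟩
    rw [denomOne]
    compute_degree!
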